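/- Let $m\ge 1$ and let $(M^{2m+1},H(M),J)$ be a connected, strictly pseudoconvex (integrable) CR manifold with a pseudo-Hermitian structure $\theta$: $\theta$ is a smooth real $1$-form with $\ker\theta=H(M)$, and $g_\theta(X,Y)=\frac12 d\theta(X,JY)$ is positive definite on $H(M)$. Let $T$ be the characteristic vector field ($\theta(T)=1$, $d\theta(T,\cdot)=0$), let $X^H=X-\theta(X)T$ denote the projection of $X$ to $H(M)$ along $T$, and let $\nabla^W$ be the Tanaka--Webster connection on $TM$. That is, $\nabla^W T=0$; for sections $X,Y,Z$ of $H(M)$, $$2g_\theta(\nabla^W_XY,Z)=X(g_\theta(Y,Z))+Y(g_\theta(X,Z))-Z(g_\theta(X,Y))+g_\theta([X,Y]^H,Z)-g_\theta([X,Z]^H,Y)-g_\theta([Y,Z]^H,X),$$ with $\nabla^W_XY$ a section of $H(M)$; and $\nabla^W_TX=\frac12([T,X]-J[T,JX])$. Let $\tau(X)=\nabla^W_TX-\nabla^W_XT-[T,X]$ be the Webster torsion (so that $\tau(T)=0$). A $k$-form $\omega$ on $M$ is horizontal if $T\lrcorner\,\omega=0$. The horizontal exterior differential is $$(d^W\omega)(X_1,\dots,X_{k+1})=(d\omega)(X_1^H,\dots,X_{k+1}^H),$$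 and $(\tau^{[k]}\omega)(X_1,\dots,X_k)=\sum_{l=1}^k\omega(X_1,\dots,\tau(X_l),\dots,X_k)$. Forms, functions and vector fields are smooth; $d$ and $\wedge$ are normalized so that $d\theta(X,Y)=X(\theta(Y))-Y(\theta(X))-\theta([X,Y])$ and $(\alpha\wedge\beta)(X_1,\dots,X_{p+q})=\frac1{p!\,q!}\sum_\sigma \mathrm{sgn}(\sigma)\,\alpha(X_{\sigma(1)},\dots,X_{\sigma(p)})\,\beta(X_{\sigma(p+1)},\dots,X_{\sigma(p+q)})$. Then, for every $k\ge 0$ and every horizontal $k$-form $\omega$, $$(d^W)^2\omega=-d\theta\wedge\tau^{[k]}\omega-d\theta\wedge\nabla^W_T\omega .$$ In particular $(d^W)^2f=-T(f)\,d\theta$ for every smooth function $f:M\to\mathbb R$, and on every such $M$ there is a smooth function $f$ with $(d^W)^2f\ne0$. -/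

import Mathlib

open scoped Manifold ContDiff Topology

noncomputable section

namespace CRGeometry

section Manifold

variable {E : Type*} [NormedAddCommGroup E] [NormedSpace ℝ E]
  {M : Type*} [TopologicalSpace M] [ChartedSpace E M]

/-! ### Vector fields and differential forms -/

variable (E M) in
/-- A (not necessarily smooth) vector field on `M`. -/
abbrev VField : Type _ := ∀ x : M, TangentSpace 𝓘(ℝ, E) x

variable (E M) in
/-- A (not necessarily smooth) differential `k`-form on `M`. -/
abbrev DiffForm (k : ℕ) : Type _ := ∀ x : M, TangentSpace 𝓘(ℝ, E) x [⋀^Fin k]→L[ℝ] ℝ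

/-- The vector field `X` is smooth, as a section of the tangent bundle. -/
def SmoothField [IsManifold 𝓘(ℝ, E) 1 M] (X : VField E M) : Prop :=
  ContMDiff 𝓘(ℝ, E) 𝓘(ℝ, E).tangent ∞ (fun x => (⟨x, X x⟩ : TangentBundle 𝓘(ℝ, E) M))

/-- The derivative `X(f)` of the function `f` along the vector field `X`. -/
def dirDeriv (X : VField E M) (f : M → ℝ) (x : M) : ℝ := mvfderiv 𝓘(ℝ, E) f x (X x)

/-- The Lie bracket `[X, Y]`. -/
abbrev bracket (X Y : VField E M) : VField E M := VectorField.mlieBracket 𝓘(ℝ, E) X Y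

/-- The form `η` in the chart centred at `c`: the pull-back of `η` by the inverse of the chart. -/
def chartRep {k : ℕ} (η : DiffForm E M k) (c : M) (y : E) : E [⋀^Fin k]→L[ℝ] ℝ :=
  (η ((extChartAt 𝓘(ℝ, E) c).symm y)).compContinuousLinearMap
    (mfderiv 𝓘(ℝ, E) 𝓘(ℝ, E) (extChartAt 𝓘(ℝ, E) c).symm y)

/-- The form `η` is smooth: it is so in all charts of the atlas centred at points of `M`. -/
def SmoothForm {k : ℕ} (η : DiffForm E M k) : Prop :=
  ∀ c : M, ContDiffOn ℝ ∞ (chartRep η c) (extChartAt 𝓘(ℝ, E) c).target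

/-- The exterior differential of a form on `M`, computed at `x` in the chart centred at `x`.
The normalization is
`dη(X₀, …, Xₖ) = ∑ (-1)ⁱ Xᵢ(η(…, X̂ᵢ, …)) + ∑_{i<j} (-1)^{i+j} η([Xᵢ, Xⱼ], …)`. -/
def extD {k : ℕ} (η : DiffForm E M k) : DiffForm E M (k + 1) := fun x =>
  (extDeriv (chartRep η x) (extChartAt 𝓘(ℝ, E) x x)).compContinuousLinearMap
    (mfderiv 𝓘(ℝ, E) 𝓘(ℝ, E) (extChartAt 𝓘(ℝ, E) x) x)

/-- A function, seen as a differential form of degree `0`. -/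
def zeroForm (f : M → ℝ) : DiffForm E M 0 := fun x =>
  ContinuousAlternatingMap.constOfIsEmpty ℝ (TangentSpace 𝓘(ℝ, E) x) (Fin 0) (f x)

/-! ### Forms as functionals on vector fields, and the wedge product -/

variable (E M) in
/-- A functional sending `k` vector fields to a function. -/
abbrev FieldFunctional (k : ℕ) : Type _ := (Fin k → VField E M) → M → ℝ

/-- The functional on vector fields `(X₁, …, Xₖ) ↦ η(X₁, …, Xₖ)` given by a form. -/
def DiffForm.onFields {k : ℕ} (η : DiffForm E M k) : FieldFunctional E M k :=
  fun X x => η x (fun i => X i x)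

/-- The wedge product of alternating functionals, in the normalization
`(α ∧ β)(X₁, …, X_{p+q}) = 1/(p! q!) ∑_σ sign(σ) α(X_{σ(1)}, …, X_{σ(p)})
  β(X_{σ(p+1)}, …, X_{σ(p+q)})`, that is a sum over the `(p, q)`-shuffles. -/
def wedge {p q n : ℕ} (h : p + q = n) (α : FieldFunctional E M p) (β : FieldFunctional E M q) :
    FieldFunctional E M n := fun X x =>
  ((p.factorial : ℝ) * (q.factorial : ℝ))⁻¹ * ∑ σ : Equiv.Perm (Fin n),
    ((Equiv.Perm.sign σ : ℤ) : ℝ) *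
      (α (fun i => X (σ (Fin.cast h (Fin.castAdd q i)))) x *
        β (fun j => X (σ (Fin.cast h (Fin.natAdd p j)))) x)

/-! ### CR structures and pseudo-Hermitian structures -/

variable (E M) in
/-- An integrable CR structure of hypersurface type: a smooth subbundle `H` of corank one of the
tangent bundle with a smooth complex structure `J` on it, which is integrable.

`J` is given as a field of endomorphisms of the tangent spaces that preserve `H`; only its
restriction to `H` has a meaning and only that restriction is used. -/
structure CRStructure [IsManifold 𝓘(ℝ, E) 1 M] where
  /-- The fibres of the distribution `H(M)`. -/
  H : ∀ x : M, Submodule ℝ (TangentSpace 𝓘(ℝ, E) x)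
  corank_one : ∀ x, Module.finrank ℝ (TangentSpace 𝓘(ℝ, E) x ⧸ H x) = 1
  /-- `H` is a smooth subbundle: its vectors extend to smooth sections of `H`. -/
  smooth_H : ∀ x, ∀ v ∈ H x, ∃ X : VField E M, SmoothField X ∧ (∀ y, X y ∈ H y) ∧ X x = v
  J : ∀ x : M, TangentSpace 𝓘(ℝ, E) x →ₗ[ℝ] TangentSpace 𝓘(ℝ, E) x
  J_mem : ∀ x, ∀ v ∈ H x, J x v ∈ H x
  J_sq : ∀ x, ∀ v ∈ H x, J x (J x v) = -v
  smooth_J : ∀ X : VField E M, SmoothField X → (∀ y, X y ∈ H y) → SmoothField fun y => J y (X y)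
  /-- Partial integrability: `[JX, Y] + [X, JY]` is a section of `H`. -/
  partially_integrable : ∀ X Y : VField E M, SmoothField X → SmoothField Y →
    (∀ y, X y ∈ H y) → (∀ y, Y y ∈ H y) → ∀ x,
      bracket (fun y => J y (X y)) Y x + bracket X (fun y => J y (Y y)) x ∈ H x
  /-- The Nijenhuis tensor vanishes. -/
  nijenhuis : ∀ X Y : VField E M, SmoothField X → SmoothField Y →
    (∀ y, X y ∈ H y) → (∀ y, Y y ∈ H y) → ∀ x,
      bracket X Y x - bracket (fun y => J y (X y)) (fun y => J y (Y y)) x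
        + J x (bracket (fun y => J y (X y)) Y x + bracket X (fun y => J y (Y y)) x) = 0

variable (E M) in
/-- A CR structure with a pseudo-Hermitian structure: a smooth `1`-form `θ` with kernel `H` such
that `g_θ(X, Y) = ½ dθ(X, JY)` is positive definite on `H`. (The CR structure is then strictly
pseudoconvex: positivity makes `dθ` nondegenerate on `H`, so that `H` is contact, and the
`TM/H`-valued pairing `(X, Y) ↦ -[X, JY]` is, through `θ`, equal to `2 g_θ`.) -/
structure PseudoHermitian [IsManifold 𝓘(ℝ, E) 1 M] extends CRStructure E M where
  θ : DiffForm E M 1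
  smooth_θ : SmoothForm θ
  ker_θ : ∀ x (v : TangentSpace 𝓘(ℝ, E) x), θ x ![v] = 0 ↔ v ∈ H x
  pos : ∀ x, ∀ v ∈ H x, v ≠ 0 → 0 < (1 / 2 : ℝ) * extD θ x ![v, J x v]

namespace PseudoHermitian

variable [IsManifold 𝓘(ℝ, E) 1 M] (P : PseudoHermitian E M)

/-- `g_θ(v, w) = ½ dθ(v, Jw)`, used for `v, w ∈ H`. -/
def g (x : M) (v w : TangentSpace 𝓘(ℝ, E) x) : ℝ :=
  (1 / 2 : ℝ) * extD P.θ x ![v, P.J x w]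

/-- There is a vector `t` with `θ(t) = 1` and `dθ(t, ·) = 0`. -/
theorem exists_charVec [FiniteDimensional ℝ E] (x : M) : ∃ t : TangentSpace 𝓘(ℝ, E) x,
    P.θ x ![t] = 1 ∧ ∀ v, extD P.θ x ![t, v] = 0 := by
  have : FiniteDimensional ℝ (TangentSpace 𝓘(ℝ, E) x) := inferInstanceAs (FiniteDimensional ℝ E)
  let a : TangentSpace 𝓘(ℝ, E) x →ₗ[ℝ] ℝ :=
    ((ContinuousAlternatingMap.ofSubsingleton ℝ _ ℝ (0 : Fin 1)).symm (P.θ x)).toLinearMap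
  have ha : ∀ v, a v = P.θ x ![v] := fun v => by
    change P.θ x (fun _ => v) = _
    congr 1
    ext i
    fin_cases i
    rfl
  let β := (extD P.θ x).toAlternatingMap
  let B : TangentSpace 𝓘(ℝ, E) x →ₗ[ℝ] TangentSpace 𝓘(ℝ, E) x →ₗ[ℝ] ℝ :=
    LinearMap.mk₂ ℝ (fun v w => (β.curryLeft v).curryLeft w ![]) (by simp) (by simp) (by simp)
      (by simp)
  have hB : ∀ v w, B v w = extD P.θ x ![v, w] := fun v w => rfl
  have hBalt : ∀ v, B v v = 0 := fun v =>
    (extD P.θ x).map_eq_zero_of_eq ![v, v] (i := 0) (j := 1) rfl (by decide)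
  have hkey : ∃ t, a t = 1 ∧ ∀ v, B t v = 0 := by
    obtain ⟨u, hu⟩ : ∃ u, a u ≠ 0 := by
      by_contra! h
      have htop : P.H x = ⊤ := by
        rw [eq_top_iff]
        intro v _
        exact (P.ker_θ x v).1 ((ha v).symm.trans (h v))
      have h1 := P.corank_one x
      have h2 : Subsingleton (TangentSpace 𝓘(ℝ, E) x ⧸ P.H x) :=
        Submodule.Quotient.subsingleton_iff.2 htop
      rw [Module.finrank_zero_of_subsingleton] at h1
      exact zero_ne_one h1
    let L : P.H x →ₗ[ℝ] Module.Dual ℝ (P.H x) :=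
      (B.domRestrict₁₂ (P.H x) (P.H x))
    have hinj : Function.Injective L := by
      rw [injective_iff_map_eq_zero]
      intro h hh
      by_contra hne
      have hp := P.pos x h h.2 (fun h0 => hne (Subtype.ext h0))
      have hz : L h ⟨P.J x h, P.J_mem x h h.2⟩ = 0 := by rw [hh]; rfl
      have hz' : extD P.θ x ![(h : TangentSpace 𝓘(ℝ, E) x), P.J x h] = 0 := hz
      rw [hz', mul_zero] at hp
      exact lt_irrefl _ hp
    have hsurj : Function.Surjective L :=
      (LinearMap.injective_iff_surjective_of_finrank_eq_finrank
        (Subspace.dual_finrank_eq (K := ℝ) (V := P.H x)).symm).1 hinj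
    set w := (a u)⁻¹ • u with hw
    have haw : a w = 1 := by simp [hw, hu]
    obtain ⟨h, hh⟩ := hsurj ((B w).domRestrict (P.H x))
    have hah : a h = 0 := (ha _).trans ((P.ker_θ x _).2 h.2)
    have hat : a (w - h) = 1 := by rw [map_sub, haw, hah, sub_zero]
    have hH : ∀ v ∈ P.H x, B (w - h) v = 0 := by
      intro v hv
      have h3 : B h v = B w v := LinearMap.congr_fun hh ⟨v, hv⟩
      rw [map_sub, LinearMap.sub_apply, h3, sub_self]
    refine ⟨w - h, hat, fun v => ?_⟩
    have hv : v - a v • (w - h) ∈ P.H x := by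
      rw [← P.ker_θ, ← ha, map_sub, map_smul, hat, smul_eq_mul, mul_one, sub_self]
    have h4 := hH _ hv
    rw [map_sub, map_smul, hBalt, smul_zero, sub_zero] at h4
    exact h4
  obtain ⟨t, ht, htB⟩ := hkey
  exact ⟨t, (ha t).symm.trans ht, fun v => (hB t v).symm.trans (htB v)⟩

/-- The characteristic vector field `T`: `θ(T) = 1` and `dθ(T, ·) = 0`. -/
def T [FiniteDimensional ℝ E] : VField E M := fun x => (P.exists_charVec x).choose

variable [FiniteDimensional ℝ E]

/-- The projection `π_θ` to `H` along `T`. -/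
def proj (x : M) : TangentSpace 𝓘(ℝ, E) x →L[ℝ] TangentSpace 𝓘(ℝ, E) x :=
  ContinuousLinearMap.id ℝ _ -
    ((ContinuousAlternatingMap.ofSubsingleton ℝ _ ℝ (0 : Fin 1)).symm (P.θ x)).smulRight (P.T x)

/-- The horizontal part `X^H` of a vector field. -/
def hor (X : VField E M) : VField E M := fun x => P.proj x (X x)

/-- The function `θ(X)`. -/
def thetaOf (X : VField E M) : M → ℝ := fun x => P.θ x ![X x]

/-- The field `JX`, for a section `X` of `H`. -/
def JField (X : VField E M) : VField E M := fun x => P.J x (X x)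

/-- The function `g_θ(X, Y)`, for sections `X`, `Y` of `H`. -/
def gField (X Y : VField E M) : M → ℝ := fun x => P.g x (X x) (Y x)

/-! ### The Tanaka-Webster connection -/

/-- The partial connection on `H`: for sections `X`, `Y` of `H`, the vector `∇_X Y` at `x` is the
vector `w ∈ H` that satisfies the Koszul formula against all smooth sections `Z` of `H`. -/
def partialNabla (X Y : VField E M) : VField E M := fun x =>
  Classical.epsilon fun w : TangentSpace 𝓘(ℝ, E) x => w ∈ P.H x ∧
    ∀ Z : VField E M, SmoothField Z → (∀ y, Z y ∈ P.H y) →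
      2 * P.g x w (Z x) =
        dirDeriv X (P.gField Y Z) x + dirDeriv Y (P.gField X Z) x - dirDeriv Z (P.gField X Y) x
          + P.g x (P.hor (bracket X Y) x) (Z x)
          - P.g x (P.hor (bracket X Z) x) (Y x)
          - P.g x (P.hor (bracket Y Z) x) (X x)

/-- `∇_T X = ½ ([T, X] - J [T, JX])`, for sections `X` of `H`. -/
def nablaT (X : VField E M) : VField E M := fun x =>
  (1 / 2 : ℝ) • (bracket P.T X x - P.J x (bracket P.T (P.JField X) x))

/-- The Tanaka-Webster connection `∇_X Y`: the extension of the partial connection on `H` and of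
`∇_T` on `H` by `∇T = 0`. Here `X = X^H + θ(X) T` and `Y = Y^H + θ(Y) T`. -/
def nabla (X Y : VField E M) : VField E M := fun x =>
  P.partialNabla (P.hor X) (P.hor Y) x + P.thetaOf X x • P.nablaT (P.hor Y) x
    + dirDeriv X (P.thetaOf Y) x • P.T x

/-- The torsion `Tor(X, Y) = ∇_X Y - ∇_Y X - [X, Y]`. -/
def torsion (X Y : VField E M) : VField E M := fun x =>
  P.nabla X Y x - P.nabla Y X x - bracket X Y x

/-- The Webster torsion `τ(X) = Tor(T, X)`. On `T` itself it vanishes. -/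
def tau (X : VField E M) : VField E M := P.torsion P.T X

/-- The covariant derivative of forms induced by the Tanaka-Webster connection:
`(∇_X η)(Y₁, …, Yₖ) = X(η(Y₁, …, Yₖ)) - ∑ₗ η(Y₁, …, ∇_X Yₗ, …, Yₖ)`. -/
def nablaForm {k : ℕ} (X : VField E M) (η : DiffForm E M k) : FieldFunctional E M k :=
  fun Y x => dirDeriv X (η.onFields Y) x
    - ∑ l : Fin k, η.onFields (Function.update Y l (P.nabla X (Y l))) x

/-- The extension `τ^{[k]}` of `τ` to forms:
`(τ^{[k]} η)(Y₁, …, Yₖ) = ∑ₗ η(Y₁, …, τ(Yₗ), …, Yₖ)`. -/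
def tauExt {k : ℕ} (η : DiffForm E M k) : FieldFunctional E M k :=
  fun Y x => ∑ l : Fin k, η.onFields (Function.update Y l (P.tau (Y l))) x

/-! ### Horizontal forms -/

/-- The form `η` is horizontal: its contraction with `T` vanishes. -/
def IsHorizontal {k : ℕ} (η : DiffForm E M k) : Prop :=
  ∀ (x : M) (v : Fin k → TangentSpace 𝓘(ℝ, E) x) (i : Fin k), v i = P.T x → η x v = 0

/-- The horizontal exterior differential
`(d^W η)(X₁, …, X_{k+1}) = (dη)(X₁^H, …, X_{k+1}^H)`. -/
def dW {k : ℕ} (η : DiffForm E M k) : DiffForm E M (k + 1) := fun x =>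
  (extD η x).compContinuousLinearMap (P.proj x)

end PseudoHermitian

end Manifold

end CRGeometry

end

noncomputable section

namespace CRGeometry

/-! ### Alternating maps and signed sums over permutations. -/

section Algebra

variable {V : Type*} [AddCommGroup V] [Module ℝ V]

/-! With `π = id - θ ⊗ T`, the horizontal differential is `d^W ω = (dω) ∘ π`. Differentiating `(dω)
∘ π` and evaluating on horizontal vectors gives two kinds of terms. Those that differentiate `dω`
add up to `d(dω) = 0`. Those that differentiate `π` put `-(Dθ)(v_i)(v_l) T` into a slot of `dω`, and
antisymmetrising `Dθ` yields `dθ`. Hence `(d^W)²ω = -dθ ∧ (T ⌟ dω)` on horizontal vectors, and then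
on all vectors, because `dθ` and `T ⌟ dω` both annihilate `T`. The computation is
`extDeriv_compProj` in a vector space and `dW_dW_apply` on `M`. It needs a differentiable `T`, which
`contDiffAt_of_reeb` provides.

For horizontal `ω`, Cartan's formula makes `T ⌟ dω` the Lie derivative of `ω` along `T`
(`extD_T_apply`). Since `∇T = 0` (`nabla_T`), `τ(Y) = ∇_T Y - [T, Y]`; the terms in `∇_T Y` cancel
between `τ^{[k]}ω` and `∇_T ω`, which leaves that Lie derivative (`tauExt_add_nablaForm`).

On functions `T ⌟ df = T(f)`. As `T` vanishes nowhere and `dθ` is nonzero on `H ≠ 0`, a cut-off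
linear function with `T(f) ≠ 0` at one point has `(d^W)²f ≠ 0`. -/

theorem alternatingMap_sub_smul_eq {k : ℕ} (f : V [⋀^Fin k]→ₗ[ℝ] ℝ) (t : V)
    (hf : ∀ (v : Fin k → V) (i : Fin k), v i = t → f v = 0) (c : Fin k → ℝ) (v : Fin k → V) :
    f (fun i => v i - c i • t) = f v := by
  have key : ∀ (w : Fin k → V) (i : Fin k) (r : ℝ), w i = r • t → f w = 0 := by
    intro w i r hw
    have h : f w = r • f (Function.update w i t) := by
      rw [← f.map_update_smul, ← hw, Function.update_eq_self]
    rw [h, hf _ i (Function.update_self ..), smul_zero]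
  have h1 : (fun i => v i - c i • t) = v + fun i => (-c i) • t := by
    ext i
    simp [sub_eq_add_neg]
  rw [h1]
  change f.toMultilinearMap (v + _) = _
  -- The expansion runs over the sets of slots that keep `v i`; every other slot holds a multiple of
  -- `t`, so only the full set contributes.
  rw [f.toMultilinearMap.map_add_univ]
  rw [Finset.sum_eq_single Finset.univ]
  · simp
  · intro s _ hs
    obtain ⟨i, hi⟩ : ∃ i, i ∉ s := by
      by_contra! h
      exact hs (Finset.eq_univ_iff_forall.2 h)
    exact key _ i (-c i) (by simp [Finset.piecewise, hi])
  · simp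

/-- Laplace expansion: permutations are grouped by the image `i` of `0`. It turns the permutation
sum in a wedge product into the alternating sums found in `extDeriv`. -/
theorem sum_perm_succ {W : Type*} {n : ℕ} (F : (Fin (n + 1) → W) → ℝ) (v : Fin (n + 1) → W) :
    ∑ σ : Equiv.Perm (Fin (n + 1)), ((Equiv.Perm.sign σ : ℤ) : ℝ) * F (v ∘ σ) =
      ∑ i : Fin (n + 1), (-1 : ℝ) ^ (i : ℕ) * ∑ τ : Equiv.Perm (Fin n),
        ((Equiv.Perm.sign τ : ℤ) : ℝ) * F (Matrix.vecCons (v i) (i.removeNth v ∘ τ)) := by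
  rw [Finset.univ_perm_fin_succ, ← Finset.univ_product_univ]
  simp only [Finset.sum_map, Equiv.toEmbedding_apply, Finset.sum_product]
  refine Finset.sum_congr rfl fun i _ => Fin.cases ?_ (fun i => ?_) i
  · rw [Fin.val_zero, pow_zero, one_mul]
    refine Finset.sum_congr rfl fun σ _ => ?_
    rw [Equiv.Perm.decomposeFin.symm_sign, if_pos rfl, one_mul]
    congr 2
    ext j
    refine Fin.cases ?_ (fun j => ?_) j <;> simp [Fin.tail]
  · rw [Finset.mul_sum]
    -- `decomposeFin` moves the chosen index by a transposition, which leaves the others out of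
    -- order; `i.cycleRange` restores the order of `removeNth` at the cost of the sign `(-1) ^ i`.
    refine Fintype.sum_equiv (Equiv.mulLeft i.cycleRange) _ _ fun σ => ?_
    have e : v ∘ (Equiv.Perm.decomposeFin.symm (i.succ, σ)) =
        Matrix.vecCons (v i.succ) (i.succ.removeNth v ∘ ⇑(Equiv.mulLeft i.cycleRange σ)) := by
      ext j
      refine Fin.cases ?_ (fun j => ?_) j
      · simp
      · simp [Fin.removeNth, Fin.succAbove_cycleRange]
    rw [e, Equiv.Perm.decomposeFin.symm_sign, if_neg (Fin.succ_ne_zero i), Equiv.coe_mulLeft,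
      Equiv.Perm.sign_mul, Fin.sign_cycleRange, ← mul_assoc]
    congr 1
    push_cast
    rw [← mul_assoc, ← pow_add, Fin.val_succ, Odd.neg_one_pow ⟨i, by ring⟩]

theorem sum_perm_alternating {k : ℕ} (f : V [⋀^Fin k]→ₗ[ℝ] ℝ) (v : Fin k → V) :
    ∑ σ : Equiv.Perm (Fin k), ((Equiv.Perm.sign σ : ℤ) : ℝ) * f (v ∘ σ) = k.factorial * f v := by
  have : ∀ σ : Equiv.Perm (Fin k), ((Equiv.Perm.sign σ : ℤ) : ℝ) * f (v ∘ σ) = f v := by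
    intro σ
    rw [f.map_perm, Units.smul_def, zsmul_eq_mul, ← mul_assoc, ← Int.cast_mul,
      ← Units.val_mul, Int.units_mul_self]
    simp
  simp [this, Fintype.card_perm]

/-- Expand along the first two slots in turn; the permutations of the remaining `k` slots all
contribute equally, whence `k!`. -/
theorem sum_perm_two_add {k : ℕ} (b : V → V → ℝ) (f : V [⋀^Fin k]→ₗ[ℝ] ℝ) (v : Fin (k + 2) → V) :
    ∑ σ : Equiv.Perm (Fin (k + 2)), ((Equiv.Perm.sign σ : ℤ) : ℝ) *
        (b (v (σ 0)) (v (σ 1)) * f (fun j => v (σ j.succ.succ))) =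
      k.factorial * ∑ i : Fin (k + 2), (-1 : ℝ) ^ (i : ℕ) * ∑ j : Fin (k + 1), (-1 : ℝ) ^ (j : ℕ) *
        (b (v i) (i.removeNth v j) * f (j.removeNth (i.removeNth v))) := by
  have h := sum_perm_succ (fun w : Fin (k + 2) → V => b (w 0) (w 1) * f (fun j => w j.succ.succ)) v
  refine h.trans ?_
  rw [Finset.mul_sum]
  refine Finset.sum_congr rfl fun i _ => ?_
  rw [mul_left_comm]
  congr 1
  have h2 := sum_perm_succ (fun w : Fin (k + 1) → V => b (v i) (w 0) * f (fun j => w j.succ))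
    (i.removeNth v)
  refine h2.trans ?_
  rw [Finset.mul_sum]
  refine Finset.sum_congr rfl fun j _ => ?_
  rw [mul_left_comm]
  congr 1
  have h3 := sum_perm_alternating f (j.removeNth (i.removeNth v))
  rw [mul_left_comm, ← h3, Finset.mul_sum]
  refine Finset.sum_congr rfl fun τ _ => ?_
  rw [mul_left_comm]
  rfl

/-- Swapping the first two slots reverses the sign, so antisymmetrising `b` merely doubles the sum.
This accounts for the `2!` in the wedge with `dθ`. -/
theorem sum_perm_mul_sub {k : ℕ} (b : V → V → ℝ) (f : V [⋀^Fin k]→ₗ[ℝ] ℝ) (v : Fin (k + 2) → V) :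
    ∑ σ : Equiv.Perm (Fin (k + 2)), ((Equiv.Perm.sign σ : ℤ) : ℝ) *
        ((b (v (σ 0)) (v (σ 1)) - b (v (σ 1)) (v (σ 0))) * f (fun j => v (σ j.succ.succ))) =
      2 * ∑ σ : Equiv.Perm (Fin (k + 2)), ((Equiv.Perm.sign σ : ℤ) : ℝ) *
        (b (v (σ 0)) (v (σ 1)) * f (fun j => v (σ j.succ.succ))) := by
  have h : ∑ σ : Equiv.Perm (Fin (k + 2)), ((Equiv.Perm.sign σ : ℤ) : ℝ) *
        (b (v (σ 1)) (v (σ 0)) * f (fun j => v (σ j.succ.succ))) =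
      -∑ σ : Equiv.Perm (Fin (k + 2)), ((Equiv.Perm.sign σ : ℤ) : ℝ) *
        (b (v (σ 0)) (v (σ 1)) * f (fun j => v (σ j.succ.succ))) := by
    rw [← Equiv.sum_comp (Equiv.mulRight (Equiv.swap (0 : Fin (k + 2)) 1)), ← Finset.sum_neg_distrib]
    refine Finset.sum_congr rfl fun σ _ => ?_
    have h2 : ∀ j : Fin k, Equiv.swap (0 : Fin (k + 2)) 1 j.succ.succ = j.succ.succ := fun j =>
      Equiv.swap_apply_of_ne_of_ne (by simp [Fin.ext_iff]) (by simp [Fin.ext_iff])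
    have h3 : Equiv.Perm.sign (Equiv.swap (0 : Fin (k + 2)) 1) = -1 :=
      Equiv.Perm.sign_swap (by simp)
    simp [h2, h3]
  simp only [sub_mul, mul_sub, Finset.sum_sub_distrib, h]
  ring

end Algebra

/-! ### Exterior derivatives in a normed space. -/

section Flat

variable {E : Type*} [NormedAddCommGroup E] [NormedSpace ℝ E]

theorem update_eq_neg_one_pow_mul {n : ℕ} (f : E [⋀^Fin (n + 1)]→L[ℝ] ℝ) (v : Fin (n + 1) → E)
    (i : Fin (n + 1)) (w : E) :
    f (Function.update v i w) = (-1 : ℝ) ^ (i : ℕ) * f (Matrix.vecCons w (i.removeNth v)) := by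
  have h := f.toAlternatingMap.map_insertNth i w (i.removeNth v)
  rw [Fin.insertNth_removeNth] at h
  refine h.trans ?_
  rw [zsmul_eq_mul]
  simp

/-- Cartan's formula for the Lie derivative of a form annihilated by the field `t`. -/
theorem extDeriv_vecCons_eq {k : ℕ} {A : E → E [⋀^Fin k]→L[ℝ] ℝ} {t : E → E} {Y : Fin k → E → E}
    {y : E} (hA : DifferentiableAt ℝ A y) (ht : DifferentiableAt ℝ t y)
    (hY : ∀ i, DifferentiableAt ℝ (Y i) y)
    (h0 : ∀ᶠ z in 𝓝 y, ∀ (v : Fin k → E) (i : Fin k), v i = t z → A z v = 0) :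
    extDeriv A y (Matrix.vecCons (t y) (fun i => Y i y)) =
      fderiv ℝ (fun z => A z (fun i => Y i z)) y (t y) -
        ∑ l, A y (Function.update (fun i => Y i y) l (VectorField.lieBracket ℝ t (Y l) y)) := by
  -- Differentiating the identity `A(t, w) = 0` along `Y l` trades `DA(Y l)(t, w)` for `-A(Dt(Y l),
  -- w)`, one half of the bracket term.
  have h1 : ∀ l : Fin k, (-1 : ℝ) ^ ((l : ℕ) + 1) *
      fderiv ℝ A y (Y l y) (l.succ.removeNth (Matrix.vecCons (t y) (fun i => Y i y)) : Fin k → E) =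
      A y (Function.update (fun i => Y i y) l (fderiv ℝ t y (Y l y))) := by
    intro l
    cases k with
    | zero => exact l.elim0
    | succ n =>
      set w : Fin n → E := l.removeNth (fun i => Y i y) with hw
      have e : (l.succ.removeNth (Matrix.vecCons (t y) (fun i => Y i y)) : Fin (n + 1) → E) =
          Matrix.vecCons (t y) w := by
        ext j
        refine Fin.cases ?_ (fun j => ?_) j
        · simp [Fin.removeNth]
        · simp [Fin.removeNth, hw]
      -- Only slot `0` varies; the vectors `w` are frozen at `y`, so their derivatives drop out.
      let g : Fin (n + 1) → E → E := fun i => Fin.cases t (fun j _ => w j) i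
      have hg : ∀ i, DifferentiableAt ℝ (g i) y := fun i => by
        refine Fin.cases ht (fun j => ?_) i
        exact differentiableAt_const _
      have hgz : ∀ z, (fun i => g i z) = Matrix.vecCons (t z) w := fun z => by
        ext i
        refine Fin.cases rfl (fun j => rfl) i
      have h2 := fderiv_continuousAlternatingMap_apply_apply hA hg (Y l y)
      have h3 : (fun z => A z (fun i => g i z)) =ᶠ[𝓝 y] fun _ => 0 := by
        filter_upwards [h0] with z hz
        exact hz _ 0 rfl
      rw [h3.fderiv_eq, Fin.sum_univ_succ, Finset.sum_eq_zero (s := Finset.univ)] at h2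
      · rw [e, update_eq_neg_one_pow_mul, ← hw, pow_succ]
        rw [hgz] at h2
        have h4 : Function.update (Matrix.vecCons (t y) w) 0 (fderiv ℝ (g 0) y (Y l y)) =
            Matrix.vecCons (fderiv ℝ t y (Y l y)) w := by
          ext i
          refine Fin.cases rfl (fun j => rfl) i
        rw [h4] at h2
        simp at h2
        linear_combination (-1 : ℝ) ^ (l : ℕ) * h2
      · intro j _
        refine (A y).map_coord_zero j.succ ?_
        rw [Function.update_self]
        change fderiv ℝ (fun _ => w j) y _ = 0
        simp
  -- The product rule along `t` supplies the other half, `DY l(t)`.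
  have h5 := fderiv_continuousAlternatingMap_apply_apply hA hY (t y)
  rw [h5]
  rw [extDeriv, ContinuousAlternatingMap.alternatizeUncurryFin_apply, Fin.sum_univ_succ]
  simp only [VectorField.lieBracket, ContinuousAlternatingMap.map_update_sub,
    Finset.sum_sub_distrib]
  rw [Finset.sum_congr rfl fun l _ => (h1 l).symm]
  simp only [zsmul_eq_mul, Int.cast_pow, Int.cast_neg, Int.cast_one,
    Fin.val_succ, Matrix.cons_val_zero, Matrix.cons_val_succ, Fin.val_zero, pow_zero,
    one_smul]
  have h6 : (Fin.removeNth 0 (Matrix.vecCons (t y) fun i => Y i y) : Fin k → E) = fun i => Y i y := by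
    ext i
    simp [Fin.removeNth]
  rw [h6]
  ring

/-- The exterior derivative, on the kernel of `a`, of a closed form composed with the projection
`v ↦ v - a(v) t`. -/
theorem extDeriv_compProj {k : ℕ} {B : E → E [⋀^Fin (k + 1)]→L[ℝ] ℝ} {a : E → E →L[ℝ] ℝ}
    {t : E → E} {y : E} (hB : DifferentiableAt ℝ B y) (ha : DifferentiableAt ℝ a y)
    (ht : DifferentiableAt ℝ t y) (hBc : extDeriv B y = 0) (v : Fin (k + 2) → E)
    (hv : ∀ i, a y (v i) = 0) :
    extDeriv (fun z => (B z).compContinuousLinearMap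
        (ContinuousLinearMap.id ℝ E - (a z).smulRight (t z))) y v =
      -(((2 : ℕ).factorial : ℝ) * (k.factorial : ℝ))⁻¹ *
        ∑ σ : Equiv.Perm (Fin (k + 2)), ((Equiv.Perm.sign σ : ℤ) : ℝ) *
        ((fderiv ℝ a y (v (σ 0)) (v (σ 1)) - fderiv ℝ a y (v (σ 1)) (v (σ 0))) *
          B y (Matrix.vecCons (t y) (fun j => v (σ j.succ.succ)))) := by
  have hπ : DifferentiableAt ℝ (fun z => ContinuousLinearMap.id ℝ E - (a z).smulRight (t z)) y := by
    fun_prop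
  have hr := sum_perm_mul_sub (fun u w => fderiv ℝ a y u w)
    ((B y).curryLeft (t y)).toAlternatingMap v
  have hr2 := sum_perm_two_add (fun u w => fderiv ℝ a y u w)
    ((B y).curryLeft (t y)).toAlternatingMap v
  rw [hr2] at hr
  have hr' : ∑ σ : Equiv.Perm (Fin (k + 2)), ((Equiv.Perm.sign σ : ℤ) : ℝ) *
        ((fderiv ℝ a y (v (σ 0)) (v (σ 1)) - fderiv ℝ a y (v (σ 1)) (v (σ 0))) *
          B y (Matrix.vecCons (t y) (fun j => v (σ j.succ.succ)))) = _ := hr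
  rw [hr', ← mul_assoc (2 : ℝ), ← mul_assoc, neg_mul]
  have hk : ((((2 : ℕ).factorial : ℝ) * (k.factorial : ℝ))⁻¹ * (2 * k.factorial) : ℝ) = 1 := by
    have : (k.factorial : ℝ) ≠ 0 := by positivity
    simp [Nat.factorial]
    field_simp
  rw [hk, neg_one_mul, ← Finset.sum_neg_distrib]
  rw [extDeriv_apply (hB.continuousAlternatingMapCompContinuousLinearMap hπ)]
  have hB0 : ∑ i : Fin (k + 2), (-1 : ℝ) ^ (i : ℕ) * fderiv ℝ B y (v i) (i.removeNth v) = 0 := by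
    have := congrArg (fun f => f v) hBc
    rw [extDeriv] at this
    simpa [ContinuousAlternatingMap.alternatizeUncurryFin_apply] using this
  -- Closedness of `B` enters here: subtracting its vanishing alternating sum removes every term in
  -- which `B` itself is differentiated.
  rw [← sub_zero (∑ i, _), ← hB0, ← Finset.sum_sub_distrib]
  refine Finset.sum_congr rfl fun i _ => ?_
  rw [zsmul_eq_mul]
  simp only [Int.cast_pow, Int.cast_neg, Int.cast_one]
  rw [← mul_sub, ← mul_neg]
  congr 1
  set w : Fin (k + 1) → E := i.removeNth v with hw
  have hwa : ∀ l, a y (w l) = 0 := fun l => hv _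
  -- The term containing `Dt` carries the factor `a y (w l) = 0`, so only the derivative of `a`
  -- survives.
  have hd : ∀ l, HasFDerivAt (fun z => w l - a z (w l) • t z)
      (-((fderiv ℝ a y).flip (w l)).smulRight (t y)) y := by
    intro l
    have h1 : HasFDerivAt (fun z => a z (w l)) ((fderiv ℝ a y).flip (w l)) y := by
      have := ha.hasFDerivAt.clm_apply (hasFDerivAt_const (w l) y)
      simpa using this
    have h2 := (h1.smul ht.hasFDerivAt).const_sub (w l)
    refine h2.congr_fderiv ?_
    rw [hwa l]
    ext u
    simp
  have h3 := fderiv_continuousAlternatingMap_apply_apply hB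
    (fun l => (hd l).differentiableAt) (v i)
  have h4 : (fun l => w l - a y (w l) • t y) = w := by
    ext l
    simp [hwa]
  have h5 : (fun z => (B z).compContinuousLinearMap
        (ContinuousLinearMap.id ℝ E - (a z).smulRight (t z)) w) =
      fun z => B z (fun l => w l - a z (w l) • t z) := by
    ext z
    rfl
  rw [h5, h3, h4, add_sub_cancel_left, ← Finset.sum_neg_distrib]
  refine Finset.sum_congr rfl fun l _ => ?_
  rw [(hd l).fderiv, update_eq_neg_one_pow_mul]
  have h6 : Matrix.vecCons ((-((fderiv ℝ a y).flip (w l)).smulRight (t y)) (v i)) (l.removeNth w) =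
      Function.update (Matrix.vecCons (t y) (l.removeNth w)) 0 ((-(fderiv ℝ a y (v i) (w l))) • t y) := by
    ext j
    refine Fin.cases ?_ (fun j => rfl) j
    simp
  rw [h6, (B y).map_update_smul]
  have h7 : Function.update (Matrix.vecCons (t y) (l.removeNth w)) 0 (t y) =
      Matrix.vecCons (t y) (l.removeNth w) := Function.update_eq_self 0 _
  rw [h7]
  change _ = -((-1 : ℝ) ^ (l : ℕ) * (_ * B y (Matrix.vecCons (t y) (l.removeNth w))))
  rw [smul_eq_mul]
  ring

end Flat

/-! ### Forms, fields and brackets in charts. -/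

section Charts

variable {E : Type*} [NormedAddCommGroup E] [NormedSpace ℝ E]
  {M : Type*} [TopologicalSpace M] [ChartedSpace E M]

/-- Every tangent space is the model space `E`, so the base point can be changed without
transporting the vectors. -/
theorem DiffForm.apply_congr {k : ℕ} (η : DiffForm E M k) {p q : M} (h : p = q)
    {v w : Fin k → E} (hvw : v = w) :
    (η p : E [⋀^Fin k]→L[ℝ] ℝ) v = (η q : E [⋀^Fin k]→L[ℝ] ℝ) w := by
  subst h hvw
  rfl

variable (E) in
theorem extChartAt_target_mem_nhds_of_mem {c : M} {y : E}
    (hy : y ∈ (extChartAt 𝓘(ℝ, E) c).target) : (extChartAt 𝓘(ℝ, E) c).target ∈ 𝓝 y :=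
  (isOpen_extChartAt_target c).mem_nhds hy

/-- The differential of the chart centred at `c`, with values in the model space. -/
def dChart (c x : M) : TangentSpace 𝓘(ℝ, E) x →L[ℝ] E :=
  mfderiv 𝓘(ℝ, E) 𝓘(ℝ, E) (extChartAt 𝓘(ℝ, E) c) x

/-- The differential of the inverse of the chart centred at `c`. -/
def dChartSymm (c : M) (y : E) :
    E →L[ℝ] TangentSpace 𝓘(ℝ, E) ((extChartAt 𝓘(ℝ, E) c).symm y) :=
  mfderiv 𝓘(ℝ, E) 𝓘(ℝ, E) (extChartAt 𝓘(ℝ, E) c).symm y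

/-- The vector field `V` in the chart centred at `c`. -/
def chartField (V : VField E M) (c : M) (y : E) : E :=
  dChart c ((extChartAt 𝓘(ℝ, E) c).symm y) (V ((extChartAt 𝓘(ℝ, E) c).symm y))

theorem chartRep_apply {k : ℕ} (η : DiffForm E M k) (c : M) (y : E) (v : Fin k → E) :
    chartRep η c y v = η ((extChartAt 𝓘(ℝ, E) c).symm y) (fun i => dChartSymm c y (v i)) := rfl

theorem extD_apply {k : ℕ} (η : DiffForm E M k) (x : M)
    (v : Fin (k + 1) → TangentSpace 𝓘(ℝ, E) x) :
    extD η x v = extDeriv (chartRep η x) (extChartAt 𝓘(ℝ, E) x x) (fun i => dChart x x (v i)) :=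
  rfl

theorem chartField_self (V : VField E M) (x : M) :
    chartField V x (extChartAt 𝓘(ℝ, E) x x) = dChart x x (V x) := by
  unfold chartField
  rw [extChartAt_to_inv]

theorem SmoothForm.contDiffAt {k : ℕ} {η : DiffForm E M k} (hη : SmoothForm η) {c : M} {y : E}
    (hy : y ∈ (extChartAt 𝓘(ℝ, E) c).target) : ContDiffAt ℝ ∞ (chartRep η c) y :=
  (hη c).contDiffAt (extChartAt_target_mem_nhds_of_mem E hy)

variable [IsManifold 𝓘(ℝ, E) ∞ M]

theorem contMDiffAt_extChartAt_symm_of_mem {c : M} {y : E}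
    (hy : y ∈ (extChartAt 𝓘(ℝ, E) c).target) :
    ContMDiffAt 𝓘(ℝ, E) 𝓘(ℝ, E) ∞ (extChartAt 𝓘(ℝ, E) c).symm y :=
  (contMDiffOn_extChartAt_symm c).contMDiffAt (extChartAt_target_mem_nhds_of_mem E hy)

theorem contMDiffAt_extChartAt_of_mem {c x : M} (hx : x ∈ (extChartAt 𝓘(ℝ, E) c).source) :
    ContMDiffAt 𝓘(ℝ, E) 𝓘(ℝ, E) ∞ (extChartAt 𝓘(ℝ, E) c) x :=
  contMDiffAt_extChartAt' (by simpa using hx)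

theorem dChartSymm_comp_dChart {c : M} {y : E} (hy : y ∈ (extChartAt 𝓘(ℝ, E) c).target) :
    dChartSymm c y ∘L dChart c ((extChartAt 𝓘(ℝ, E) c).symm y) = ContinuousLinearMap.id ℝ _ := by
  have h := mfderivWithin_extChartAt_symm_comp_mfderiv_extChartAt (I := 𝓘(ℝ, E)) hy
  rwa [modelWithCornersSelf_coe, Set.range_id, mfderivWithin_univ] at h

theorem dChart_comp_dChartSymm {c : M} {y : E} (hy : y ∈ (extChartAt 𝓘(ℝ, E) c).target) :
    dChart c ((extChartAt 𝓘(ℝ, E) c).symm y) ∘L dChartSymm c y = ContinuousLinearMap.id ℝ E := by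
  have h := mfderiv_extChartAt_comp_mfderivWithin_extChartAt_symm (I := 𝓘(ℝ, E)) hy
  rwa [modelWithCornersSelf_coe, Set.range_id, mfderivWithin_univ] at h

theorem dChartSymm_dChart {c : M} {y : E} (hy : y ∈ (extChartAt 𝓘(ℝ, E) c).target)
    (v : TangentSpace 𝓘(ℝ, E) ((extChartAt 𝓘(ℝ, E) c).symm y)) :
    dChartSymm c y (dChart c ((extChartAt 𝓘(ℝ, E) c).symm y) v) = v :=
  DFunLike.congr_fun (dChartSymm_comp_dChart hy) v

theorem dChart_dChartSymm {c : M} {y : E} (hy : y ∈ (extChartAt 𝓘(ℝ, E) c).target) (v : E) :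
    dChart c ((extChartAt 𝓘(ℝ, E) c).symm y) (dChartSymm c y v) = v :=
  DFunLike.congr_fun (dChart_comp_dChartSymm hy) v

theorem dChartSymm_chartField (V : VField E M) {c : M} {y : E}
    (hy : y ∈ (extChartAt 𝓘(ℝ, E) c).target) :
    dChartSymm c y (chartField V c y) = V ((extChartAt 𝓘(ℝ, E) c).symm y) :=
  dChartSymm_dChart hy _

theorem chartRep_dChart {k : ℕ} (η : DiffForm E M k) {c : M} {y : E}
    (hy : y ∈ (extChartAt 𝓘(ℝ, E) c).target)
    (v : Fin k → TangentSpace 𝓘(ℝ, E) ((extChartAt 𝓘(ℝ, E) c).symm y)) :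
    chartRep η c y (fun i => dChart c ((extChartAt 𝓘(ℝ, E) c).symm y) (v i)) =
      η ((extChartAt 𝓘(ℝ, E) c).symm y) v := by
  rw [chartRep_apply]
  simp only [dChartSymm_dChart hy]

theorem chartRep_dChart_self {k : ℕ} (η : DiffForm E M k) (x : M)
    (v : Fin k → TangentSpace 𝓘(ℝ, E) x) :
    chartRep η x (extChartAt 𝓘(ℝ, E) x x) (fun i => dChart x x (v i)) = η x v := by
  have h := chartRep_dChart η (mem_extChartAt_target (I := 𝓘(ℝ, E)) x)
  rw [extChartAt_to_inv] at h
  exact h v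

theorem chartRep_chartField {k : ℕ} (η : DiffForm E M k) {c : M} {y : E}
    (hy : y ∈ (extChartAt 𝓘(ℝ, E) c).target) (Y : Fin k → VField E M) :
    chartRep η c y (fun i => chartField (Y i) c y) =
      η.onFields Y ((extChartAt 𝓘(ℝ, E) c).symm y) :=
  chartRep_dChart η hy _

/-- The manifold bracket is defined through this pullback; on the chart target, inverting the
differential of the inverse chart gives the differential of the chart. -/
theorem mpullback_extChartAt_symm_eq (V : VField E M) {c : M} {y : E}
    (hy : y ∈ (extChartAt 𝓘(ℝ, E) c).target) :
    VectorField.mpullbackWithin 𝓘(ℝ, E) 𝓘(ℝ, E) (extChartAt 𝓘(ℝ, E) c).symm V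
      (Set.range 𝓘(ℝ, E)) y = chartField V c y := by
  rw [modelWithCornersSelf_coe, Set.range_id, VectorField.mpullbackWithin_univ]
  have h := ContinuousLinearMap.inverse_eq (dChartSymm_comp_dChart hy) (dChart_comp_dChartSymm hy)
  exact DFunLike.congr_fun h (V ((extChartAt 𝓘(ℝ, E) c).symm y))

/-- The exterior differential may be computed in any chart. -/
theorem chartRep_extD {k : ℕ} {η : DiffForm E M k} (hη : SmoothForm η) {c : M} {y : E}
    (hy : y ∈ (extChartAt 𝓘(ℝ, E) c).target) :
    chartRep (extD η) c y = extDeriv (chartRep η c) y := by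
  set z := (extChartAt 𝓘(ℝ, E) c).symm y with hz
  -- `extD` at `z` uses the chart centred at `z`, so the claim is naturality of `extDeriv` under the
  -- transition map `f`.
  set f : E → E := (extChartAt 𝓘(ℝ, E) z) ∘ (extChartAt 𝓘(ℝ, E) c).symm with hf
  have hψ := contMDiffAt_extChartAt_of_mem (E := E) (mem_extChartAt_source (I := 𝓘(ℝ, E)) z)
  have hφ := contMDiffAt_extChartAt_symm_of_mem hy
  have hfc : ContDiffAt ℝ ∞ f y := contMDiffAt_iff_contDiffAt.1 (hψ.comp y hφ)
  have hnear : ∀ᶠ y' in 𝓝 y, y' ∈ (extChartAt 𝓘(ℝ, E) c).target ∧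
      (extChartAt 𝓘(ℝ, E) c).symm y' ∈ (extChartAt 𝓘(ℝ, E) z).source :=
    Filter.Eventually.and (extChartAt_target_mem_nhds_of_mem E hy)
      (hφ.continuousAt.eventually_mem ((extChartAt_source_mem_nhds (I := 𝓘(ℝ, E)) z)))
  have heq : chartRep η c =ᶠ[𝓝 y]
      fun y' => (chartRep η z (f y')).compContinuousLinearMap (fderiv ℝ f y') := by
    -- The inverse charts must agree through `f` on a whole neighbourhood of `y'`, since their
    -- differentials at `y'` are compared.
    filter_upwards [hnear.eventually_nhds] with y' hy'
    have hy1 := hy'.self_of_nhds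
    ext v
    refine DiffForm.apply_congr η ((extChartAt 𝓘(ℝ, E) z).left_inv hy1.2).symm ?_
    ext i
    have h1 : (extChartAt 𝓘(ℝ, E) c).symm =ᶠ[𝓝 y'] (extChartAt 𝓘(ℝ, E) z).symm ∘ f := by
      filter_upwards [hy'] with w hw
      exact ((extChartAt 𝓘(ℝ, E) z).left_inv hw.2).symm
    have hfd : MDifferentiableAt 𝓘(ℝ, E) 𝓘(ℝ, E) f y' :=
      ((contMDiffAt_extChartAt_of_mem hy1.2).comp y'
        (contMDiffAt_extChartAt_symm_of_mem hy1.1)).mdifferentiableAt (by simp)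
    have hsd : MDifferentiableAt 𝓘(ℝ, E) 𝓘(ℝ, E) (extChartAt 𝓘(ℝ, E) z).symm (f y') :=
      (contMDiffAt_extChartAt_symm_of_mem
        ((extChartAt 𝓘(ℝ, E) z).map_source hy1.2)).mdifferentiableAt (by simp)
    have h2 := mfderiv_comp y' hsd hfd
    rw [mfderiv_eq_fderiv] at h2
    have h3 := h1.mfderiv_eq (I := 𝓘(ℝ, E)) (I' := 𝓘(ℝ, E))
    exact (DFunLike.congr_fun h3 (v i)).trans (DFunLike.congr_fun h2 (v i))
  rw [heq.extDeriv_eq]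
  have hyz : f y ∈ (extChartAt 𝓘(ℝ, E) z).target := mem_extChartAt_target (I := 𝓘(ℝ, E)) z
  rw [extDeriv_pullback ((hη.contDiffAt hyz).differentiableAt (by simp)) hfc
    (by simp only [minSmoothness_of_isRCLikeNormedField]; exact WithTop.coe_le_coe.2 le_top)]
  ext v
  change (extDeriv (chartRep η z) (f y)) _ = (extDeriv (chartRep η z) (f y)) _
  congr 1
  ext i
  have h2 := mfderiv_comp y (hψ.mdifferentiableAt (by simp)) (hφ.mdifferentiableAt (by simp))
  have h3 : mfderiv 𝓘(ℝ, E) 𝓘(ℝ, E) f y = fderiv ℝ f y := mfderiv_eq_fderiv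
  exact (DFunLike.congr_fun (h2.symm.trans h3) (v i))

theorem SmoothField.differentiableAt_chartField [CompleteSpace E] {V : VField E M}
    (hV : SmoothField V) (x : M) :
    DifferentiableAt ℝ (chartField V x) (extChartAt 𝓘(ℝ, E) x x) := by
  have hy := mem_extChartAt_target (I := 𝓘(ℝ, E)) x
  have hV1 : ContMDiffAt 𝓘(ℝ, E) 𝓘(ℝ, E).tangent 1
      (fun x => (⟨x, V x⟩ : TangentBundle 𝓘(ℝ, E) M)) x := (hV x).of_le (by simp)
  have h := VectorField.contMDiffWithinAt_mpullbackWithin_extChartAt_symm (I := 𝓘(ℝ, E))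
    (s := Set.univ) (n := 2) (m := 1) hV1.contMDiffWithinAt uniqueMDiffOn_univ
    (Set.mem_univ _) (by norm_num)
  rw [Set.preimage_univ, Set.inter_univ] at h
  have h1 := (contMDiffWithinAt_vectorSpace_iff_contDiffWithinAt.1 h).contDiffAt
    (extChartAt_target_mem_nhds_of_mem E hy)
  refine (h1.differentiableAt (by simp)).congr_of_eventuallyEq ?_
  filter_upwards [extChartAt_target_mem_nhds_of_mem E hy] with z hz
  exact (mpullback_extChartAt_symm_eq V hz).symm

/-- The bracket at `x` is the bracket of the chart fields pulled back by the inverse of the chart's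
differential; applying that differential undoes the pullback. -/
theorem dChart_bracket (V W : VField E M) (x : M) :
    dChart x x (bracket V W x) =
      VectorField.lieBracket ℝ (chartField V x) (chartField W x) (extChartAt 𝓘(ℝ, E) x x) := by
  have hy := mem_extChartAt_target (I := 𝓘(ℝ, E)) x
  have h : ∀ V : VField E M, VectorField.mpullbackWithin 𝓘(ℝ, E) 𝓘(ℝ, E)
      (extChartAt 𝓘(ℝ, E) x).symm V (Set.range 𝓘(ℝ, E))
        =ᶠ[𝓝 (extChartAt 𝓘(ℝ, E) x x)] chartField V x := by
    intro V
    filter_upwards [extChartAt_target_mem_nhds_of_mem E hy] with z hz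
    exact mpullback_extChartAt_symm_eq V hz
  have h1 : VectorField.lieBracketWithin ℝ (VectorField.mpullbackWithin 𝓘(ℝ, E) 𝓘(ℝ, E)
      (extChartAt 𝓘(ℝ, E) x).symm V (Set.range 𝓘(ℝ, E))) (VectorField.mpullbackWithin 𝓘(ℝ, E) 𝓘(ℝ, E)
      (extChartAt 𝓘(ℝ, E) x).symm W (Set.range 𝓘(ℝ, E)))
      ((extChartAt 𝓘(ℝ, E) x).symm ⁻¹' Set.univ ∩ Set.range 𝓘(ℝ, E)) (extChartAt 𝓘(ℝ, E) x x) =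
      VectorField.lieBracket ℝ (chartField V x) (chartField W x) (extChartAt 𝓘(ℝ, E) x x) := by
    have hs : (extChartAt 𝓘(ℝ, E) x).symm ⁻¹' Set.univ ∩ Set.range 𝓘(ℝ, E) = Set.univ := by
      simp
    rw [hs]
    refine (congrFun VectorField.lieBracketWithin_univ _).trans ?_
    exact (h V).lieBracket_vectorField_eq (h W)
  have h2 : bracket V W x = (dChart x x).inverse
      (VectorField.lieBracket ℝ (chartField V x) (chartField W x) (extChartAt 𝓘(ℝ, E) x x)) :=
    congrArg (fun u : E => (dChart x x).inverse u) h1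
  obtain ⟨e, he⟩ : (dChart x x).IsInvertible :=
    isInvertible_mfderiv_extChartAt (mem_extChartAt_source (I := 𝓘(ℝ, E)) x)
  rw [h2, ← he, ContinuousLinearMap.inverse_equiv]
  exact e.apply_symm_apply _

theorem dirDeriv_eq (V : VField E M) (x : M) {f : M → ℝ} {F : E → ℝ}
    (hF : DifferentiableAt ℝ F (extChartAt 𝓘(ℝ, E) x x))
    (hfF : ∀ y ∈ (extChartAt 𝓘(ℝ, E) x).target, F y = f ((extChartAt 𝓘(ℝ, E) x).symm y)) :
    dirDeriv V f x = fderiv ℝ F (extChartAt 𝓘(ℝ, E) x x)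
      (dChart x x (V x)) := by
  have h1 : f =ᶠ[𝓝 x] F ∘ extChartAt 𝓘(ℝ, E) x := by
    filter_upwards [extChartAt_source_mem_nhds (I := 𝓘(ℝ, E)) x] with z hz
    rw [Function.comp_apply, hfF _ ((extChartAt 𝓘(ℝ, E) x).map_source hz),
      (extChartAt 𝓘(ℝ, E) x).left_inv hz]
  have h2 := mfderiv_comp x hF.mdifferentiableAt ((contMDiffAt_extChartAt_of_mem (E := E)
    (mem_extChartAt_source (I := 𝓘(ℝ, E)) x)).mdifferentiableAt (by simp))
  have h3 := h1.mfderiv_eq (I := 𝓘(ℝ, E)) (I' := 𝓘(ℝ, ℝ))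
  rw [mfderiv_eq_fderiv] at h2
  exact (DFunLike.congr_fun h3 (V x)).trans (DFunLike.congr_fun h2 (V x))

end Charts

/-! ### One-forms and smoothness of the Reeb field. -/

section OneForms

variable {E : Type*} [NormedAddCommGroup E] [NormedSpace ℝ E]

variable (E) in
/-- The identification of alternating `1`-forms with linear functionals. -/
def toDualCLM : (E [⋀^Fin 1]→L[ℝ] ℝ) →L[ℝ] (E →L[ℝ] ℝ) :=
  (ContinuousAlternatingMap.ofSubsingletonLIE (𝕜 := ℝ) (E := E) (F := ℝ)
    (0 : Fin 1)).symm.toContinuousLinearEquiv.toContinuousLinearMap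

/-- A `1`-form on the model space as a field of linear functionals. -/
def toDual (α : E → E [⋀^Fin 1]→L[ℝ] ℝ) (y : E) : E →L[ℝ] ℝ := toDualCLM E (α y)

theorem toDual_apply (α : E → E [⋀^Fin 1]→L[ℝ] ℝ) (y v : E) : toDual α y v = α y ![v] := by
  change α y (fun _ => v) = _
  congr 1
  ext i
  fin_cases i
  rfl

theorem contDiffAt_toDual {α : E → E [⋀^Fin 1]→L[ℝ] ℝ} {y : E} (hα : ContDiffAt ℝ ∞ α y) :
    ContDiffAt ℝ ∞ (toDual α) y :=
  (toDualCLM E).contDiff.contDiffAt.comp y hα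

theorem extDeriv_eq_fderiv_toDual {α : E → E [⋀^Fin 1]→L[ℝ] ℝ} {y : E}
    (hα : DifferentiableAt ℝ α y) (u w : E) :
    extDeriv α y ![u, w] = fderiv ℝ (toDual α) y u w - fderiv ℝ (toDual α) y w u := by
  have h : fderiv ℝ (toDual α) y = (toDualCLM E) ∘L fderiv ℝ α y :=
    ((toDualCLM E).hasFDerivAt.comp y hα.hasFDerivAt).fderiv
  have h1 : ∀ u w : E, fderiv ℝ (toDual α) y u w = fderiv ℝ α y u (fun _ => w) := by
    intro u w
    rw [h]
    rfl
  rw [h1, h1, extDeriv, ContinuousAlternatingMap.alternatizeUncurryFin_apply, Fin.sum_univ_two]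
  have e0 : (Fin.removeNth 0 ![u, w] : Fin 1 → E) = fun _ => w := by
    ext i; fin_cases i; rfl
  have e1 : (Fin.removeNth 1 ![u, w] : Fin 1 → E) = fun _ => u := by
    ext i; fin_cases i; rfl
  rw [e0, e1]
  simp [sub_eq_add_neg]

/-- The Reeb field of a `1`-form is smooth: with `a` its dual field, it solves `L t = a` for
`L v = da(v, ·) + a(v) a`. -/
theorem contDiffAt_of_reeb [FiniteDimensional ℝ E] {α : E → E [⋀^Fin 1]→L[ℝ] ℝ} {t : E → E} {y : E}
    (hα : ContDiffAt ℝ ∞ α y)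
    (ht1 : ∀ᶠ z in 𝓝 y, α z ![t z] = 1)
    (ht2 : ∀ᶠ z in 𝓝 y, ∀ v, extDeriv α z ![t z, v] = 0)
    (hnd : ∀ᶠ z in 𝓝 y, ∀ v, α z ![v] = 0 → (∀ w, extDeriv α z ![v, w] = 0) → v = 0) :
    ContDiffAt ℝ ∞ t y := by
  have ha := contDiffAt_toDual hα
  set a := toDual α with ha_def
  set L : E → E →L[ℝ] E →L[ℝ] ℝ := fun z =>
    fderiv ℝ a z - (fderiv ℝ a z).flip + (a z).smulRight (a z) with hL
  have hd : ∀ᶠ z in 𝓝 y, DifferentiableAt ℝ α z :=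
    ((hα.of_le (m := 1) (by simp)).eventually (by simp)).mono fun z hz =>
      hz.differentiableAt (by simp)
  have hLv : ∀ z, DifferentiableAt ℝ α z → ∀ v w,
      L z v w = extDeriv α z ![v, w] + α z ![v] * α z ![w] := by
    intro z hz v w
    rw [extDeriv_eq_fderiv_toDual hz, ← toDual_apply, ← toDual_apply]
    rfl
  have hda : ContDiffAt ℝ ∞ (fderiv ℝ a) y := ha.fderiv_right (by exact le_rfl)
  have hLs : ContDiffAt ℝ ∞ L y := by
    have hF : ContDiff ℝ ∞ (fun g : E →L[ℝ] E →L[ℝ] ℝ => g.flip) :=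
      ContinuousLinearMap.contDiff (𝕜 := ℝ) (E := E →L[ℝ] E →L[ℝ] ℝ) (F := E →L[ℝ] E →L[ℝ] ℝ)
        (ContinuousLinearMap.flipₗᵢ ℝ E E ℝ).toContinuousLinearEquiv.toContinuousLinearMap
    have h1 : ContDiffAt ℝ ∞ (fun z => (fderiv ℝ a z).flip) y := hF.contDiffAt.comp y hda
    exact (hda.sub h1).add (ha.smulRight ha)
  have hinv : ∀ᶠ z in 𝓝 y, ∃ e : E ≃L[ℝ] (E →L[ℝ] ℝ), (e : E →L[ℝ] E →L[ℝ] ℝ) = L z := by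
    filter_upwards [ht1, ht2, hnd, hd] with z h1 h2 h3 hz
    have hinj : Function.Injective (L z) := by
      rw [injective_iff_map_eq_zero]
      intro v hv
      have hv' : ∀ w, extDeriv α z ![v, w] + α z ![v] * α z ![w] = 0 := fun w => by
        rw [← hLv z hz, hv]; rfl
      -- Pairing `L v = 0` with `t` kills the `dα` term and leaves `α(v) = 0`; nondegeneracy on the
      -- kernel then gives `v = 0`.
      have hvt : extDeriv α z ![v, t z] = 0 := by
        have := h2 v
        rw [extDeriv_eq_fderiv_toDual hz] at this ⊢
        linarith
      have h4 : α z ![v] = 0 := by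
        have := hv' (t z)
        rwa [hvt, h1, zero_add, mul_one] at this
      exact h3 v h4 fun w => by simpa [h4] using hv' w
    have hdim : Module.finrank ℝ E = Module.finrank ℝ (E →L[ℝ] ℝ) := by
      rw [← (LinearMap.toContinuousLinearMap (𝕜 := ℝ) (E := E) (F' := ℝ)).finrank_eq]
      exact (Subspace.dual_finrank_eq (K := ℝ) (V := E)).symm
    refine ⟨(LinearEquiv.ofInjectiveOfFinrankEq (L z).toLinearMap hinj hdim).toContinuousLinearEquiv, ?_⟩
    ext v
    rfl
  have hsol : t =ᶠ[𝓝 y] fun z => (L z).inverse (a z) := by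
    filter_upwards [ht1, ht2, hinv, hd] with z h1 h2 ⟨e, he⟩ hz
    have h5 : L z (t z) = a z := by
      ext w
      rw [hLv z hz, h1, h2, zero_add, one_mul, ha_def, toDual_apply]
    rw [← h5, ← he, ContinuousLinearMap.inverse_equiv]
    exact (e.symm_apply_apply _).symm
  obtain ⟨e, he⟩ := hinv.self_of_nhds
  have hI : ContDiffAt ℝ ∞ (fun z => (L z).inverse) y := by
    have h6 : ContDiffAt ℝ ∞ ContinuousLinearMap.inverse (L y) := he ▸ contDiffAt_map_inverse e
    exact h6.comp y hLs
  exact (hI.clm_apply ha).congr_of_eventuallyEq hsol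

end OneForms

/-! ### Pointwise properties of `T` and of the projection. -/

namespace PseudoHermitian

variable {E : Type*} [NormedAddCommGroup E] [NormedSpace ℝ E] [FiniteDimensional ℝ E]
  {M : Type*} [TopologicalSpace M] [ChartedSpace E M] [IsManifold 𝓘(ℝ, E) ∞ M]
  (P : PseudoHermitian E M)

theorem θ_T (x : M) : P.θ x ![P.T x] = 1 := (P.exists_charVec x).choose_spec.1

theorem extD_θ_T (x : M) (v : TangentSpace 𝓘(ℝ, E) x) : extD P.θ x ![P.T x, v] = 0 :=
  (P.exists_charVec x).choose_spec.2 v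

theorem proj_apply (x : M) (v : TangentSpace 𝓘(ℝ, E) x) :
    P.proj x v = v - P.θ x ![v] • P.T x := by
  have h : P.θ x (fun _ => v) = P.θ x ![v] := by
    congr 1
    ext i
    fin_cases i
    rfl
  rw [← h]
  rfl

theorem θ_proj (x : M) (v : TangentSpace 𝓘(ℝ, E) x) : P.θ x ![P.proj x v] = 0 := by
  have h : ∀ w, P.θ x ![w] =
      (ContinuousAlternatingMap.ofSubsingleton ℝ _ ℝ (0 : Fin 1)).symm (P.θ x) w := by
    intro w
    change _ = P.θ x (fun _ => w)
    congr 1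
    ext i
    fin_cases i
    rfl
  have h1 := P.θ_T x
  rw [proj_apply, h, map_sub, map_smul, ← h, ← h, h1, smul_eq_mul, mul_one, sub_self]

omit [FiniteDimensional ℝ E] in
theorem θ_nondegenerate (x : M) (v : TangentSpace 𝓘(ℝ, E) x) (h1 : P.θ x ![v] = 0)
    (h2 : ∀ w, extD P.θ x ![v, w] = 0) : v = 0 := by
  by_contra hv
  have := P.pos x v ((P.ker_θ x v).1 h1) hv
  rw [h2, mul_zero] at this
  exact lt_irrefl _ this

/-- The projection changes vectors by multiples of `T`, which `dθ` annihilates in either slot. -/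
theorem extD_θ_proj (x : M) (v w : TangentSpace 𝓘(ℝ, E) x) :
    extD P.θ x ![P.proj x v, P.proj x w] = extD P.θ x ![v, w] := by
  have h := alternatingMap_sub_smul_eq (extD P.θ x).toAlternatingMap (P.T x) ?_
    (fun i => P.θ x ![![v, w] i]) ![v, w]
  · refine Eq.trans ?_ h
    change extD P.θ x _ = extD P.θ x _
    congr 1
    ext i
    fin_cases i
    · exact P.proj_apply x v
    · exact P.proj_apply x w
  · intro u i hu
    have h0 : ∀ w : Fin 2 → TangentSpace 𝓘(ℝ, E) x, w 0 = P.T x → extD P.θ x w = 0 := by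
      intro w hw
      have e : w = ![P.T x, w 1] := by
        ext j
        fin_cases j
        · exact hw
        · rfl
      rw [e]
      exact P.extD_θ_T x _
    change extD P.θ x u = 0
    fin_cases i
    · exact h0 u hu
    · have h1 := (extD P.θ x).toAlternatingMap.map_swap u (i := 0) (j := 1) (by decide)
      have h2 : extD P.θ x (u ∘ Equiv.swap 0 1) = 0 := h0 _ (by simpa using hu)
      exact neg_eq_zero.1 (h1.symm.trans h2)

end PseudoHermitian

/-! ### The square of `d^W`, Cartan's formula and the connection. -/

namespace PseudoHermitian

variable {E : Type*} [NormedAddCommGroup E] [NormedSpace ℝ E] [FiniteDimensional ℝ E]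
  {M : Type*} [TopologicalSpace M] [ChartedSpace E M] [IsManifold 𝓘(ℝ, E) ∞ M]
  (P : PseudoHermitian E M)

/-- `T` is chosen point by point, yet its chart field satisfies the Reeb equations on the chart
target, and these determine it smoothly. -/
theorem contDiffAt_chartField_T {c : M} {y : E} (hy : y ∈ (extChartAt 𝓘(ℝ, E) c).target) :
    ContDiffAt ℝ ∞ (chartField P.T c) y := by
  have hn := extChartAt_target_mem_nhds_of_mem E hy
  have hd : ∀ z ∈ (extChartAt 𝓘(ℝ, E) c).target, ∀ u w : E, extDeriv (chartRep P.θ c) z ![u, w] =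
      extD P.θ ((extChartAt 𝓘(ℝ, E) c).symm z) ![dChartSymm c z u, dChartSymm c z w] := by
    intro z hz u w
    rw [← chartRep_extD P.smooth_θ hz, chartRep_apply]
    congr 1
    ext i
    fin_cases i <;> rfl
  have hθ : ∀ z (u : E), chartRep P.θ c z ![u] =
      P.θ ((extChartAt 𝓘(ℝ, E) c).symm z) ![dChartSymm c z u] := by
    intro z u
    rw [chartRep_apply]
    congr 1
    ext i
    fin_cases i
    rfl
  refine contDiffAt_of_reeb (P.smooth_θ.contDiffAt hy) ?_ ?_ ?_
  · filter_upwards [hn] with z hz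
    rw [hθ, dChartSymm_chartField _ hz, P.θ_T]
  · filter_upwards [hn] with z hz v
    rw [hd z hz, dChartSymm_chartField _ hz, P.extD_θ_T]
  · filter_upwards [hn] with z hz v h1 h2
    have h3 := P.θ_nondegenerate _ (dChartSymm c z v) ((hθ z v).symm.trans h1) fun w => by
      have h4 := h2 (dChart c _ w)
      rw [hd z hz, dChartSymm_dChart hz] at h4
      exact h4
    rw [← dChart_dChartSymm hz v, h3, map_zero]

/-- Valid at every point of the chart target, so it can be differentiated once more by
`extDeriv_compProj`. -/
theorem chartRep_dW {k : ℕ} {η : DiffForm E M k} (hη : SmoothForm η) {c : M} {y : E}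
    (hy : y ∈ (extChartAt 𝓘(ℝ, E) c).target) :
    chartRep (P.dW η) c y = (extDeriv (chartRep η c) y).compContinuousLinearMap
      (ContinuousLinearMap.id ℝ E -
        (toDual (chartRep P.θ c) y).smulRight (chartField P.T c y)) := by
  rw [← chartRep_extD hη hy]
  ext v
  change extD η _ (fun i => P.proj _ (dChartSymm c y (v i))) =
    extD η _ (fun i => dChartSymm c y (v i - toDual (chartRep P.θ c) y (v i) • chartField P.T c y))
  congr 1
  ext i
  rw [P.proj_apply, map_sub, map_smul, dChartSymm_chartField _ hy, toDual_apply, chartRep_apply]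
  congr 3
  ext j
  fin_cases j
  rfl

/-- The square of the horizontal differential is `-dθ ∧ (T ⌟ dη)`. -/
theorem dW_dW_apply {k : ℕ} {η : DiffForm E M k} (hη : SmoothForm η) (x : M)
    (v : Fin (k + 2) → TangentSpace 𝓘(ℝ, E) x) :
    P.dW (P.dW η) x v = -(((2 : ℕ).factorial : ℝ) * (k.factorial : ℝ))⁻¹ *
        ∑ σ : Equiv.Perm (Fin (k + 2)), ((Equiv.Perm.sign σ : ℤ) : ℝ) *
        (extD P.θ x ![v (σ 0), v (σ 1)] *
          extD η x (Matrix.vecCons (P.T x) (fun j => v (σ j.succ.succ)))) := by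
  have hy := mem_extChartAt_target (I := 𝓘(ℝ, E)) x
  set y := extChartAt 𝓘(ℝ, E) x x with hy_def
  have hn := extChartAt_target_mem_nhds_of_mem E hy
  have hA := hη.contDiffAt hy
  have hθ := P.smooth_θ.contDiffAt hy
  have hB : DifferentiableAt ℝ (extDeriv (chartRep η x)) y := by
    have h1 : ContDiffAt ℝ ∞ (fderiv ℝ (chartRep η x)) y := hA.fderiv_right (by exact le_rfl)
    have h2 := (ContinuousAlternatingMap.alternatizeUncurryFinCLM ℝ E ℝ (n := k)).contDiff.contDiffAt.comp y h1
    exact h2.differentiableAt (n := ∞) (by simp)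
  have hBc : extDeriv (extDeriv (chartRep η x)) y = 0 :=
    extDeriv_extDeriv_apply hA
      (by simp only [minSmoothness_of_isRCLikeNormedField]; exact WithTop.coe_le_coe.2 le_top)
  have heq : chartRep (P.dW η) x =ᶠ[𝓝 y] fun z =>
      (extDeriv (chartRep η x) z).compContinuousLinearMap (ContinuousLinearMap.id ℝ E -
        (toDual (chartRep P.θ x) z).smulRight (chartField P.T x z)) := by
    filter_upwards [hn] with z hz
    exact P.chartRep_dW hη hz
  have hθv : ∀ w : TangentSpace 𝓘(ℝ, E) x,
      toDual (chartRep P.θ x) y (dChart x x w) = P.θ x ![w] := by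
    intro w
    rw [toDual_apply, ← chartRep_dChart_self]
    congr 1
    ext j
    fin_cases j
    rfl
  have h0 : P.dW (P.dW η) x v = extDeriv (chartRep (P.dW η) x) y
      (fun i => dChart x x (P.proj x (v i))) := rfl
  -- The outer `d^W` projects its arguments, which gives the horizontality that `extDeriv_compProj`
  -- requires.
  rw [h0, heq.extDeriv_eq, extDeriv_compProj hB ((contDiffAt_toDual hθ).differentiableAt (by simp))
    ((P.contDiffAt_chartField_T hy).differentiableAt (by simp)) hBc _
    (fun i => (hθv _).trans (P.θ_proj x _))]
  congr 1
  refine Finset.sum_congr rfl fun σ _ => ?_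
  congr 2
  · rw [← extDeriv_eq_fderiv_toDual (hθ.differentiableAt (by simp)), ← P.extD_θ_proj, extD_apply]
    congr 1
    ext i
    fin_cases i <;> rfl
  · rw [chartField_self]
    -- `T ⌟ dη` annihilates `T` because `dη` is alternating, so the projections on the remaining
    -- arguments can be dropped.
    have h2 := alternatingMap_sub_smul_eq ((extD η x).toAlternatingMap.curryLeft (P.T x)) (P.T x)
      (fun u i hu => (extD η x).map_eq_zero_of_eq (Matrix.vecCons (P.T x) u) (i := 0) (j := i.succ)
        (by simp [hu]) (Fin.succ_ne_zero i).symm)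
      (fun j => P.θ x ![v (σ j.succ.succ)]) (fun j => v (σ j.succ.succ))
    refine Eq.trans ?_ h2
    change _ = extD η x (Matrix.vecCons (P.T x) _)
    rw [extD_apply]
    congr 1
    ext i
    refine Fin.cases rfl (fun j => ?_) i
    change dChart x x (P.proj x _) = dChart x x _
    rw [P.proj_apply]
    rfl

/-- Cartan's formula for the Lie derivative of a horizontal form along `T`. -/
theorem extD_T_apply {k : ℕ} {η : DiffForm E M k} (hη : SmoothForm η) (hh : P.IsHorizontal η)
    {Y : Fin k → VField E M} (hY : ∀ i, SmoothField (Y i)) (x : M) :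
    extD η x (Matrix.vecCons (P.T x) (fun i => Y i x)) = dirDeriv P.T (η.onFields Y) x -
      ∑ l, η.onFields (Function.update Y l (bracket P.T (Y l))) x := by
  have hy := mem_extChartAt_target (I := 𝓘(ℝ, E)) x
  set y := extChartAt 𝓘(ℝ, E) x x with hy_def
  have hn := extChartAt_target_mem_nhds_of_mem E hy
  have hA : DifferentiableAt ℝ (chartRep η x) y := (hη.contDiffAt hy).differentiableAt (by simp)
  have hT := (P.contDiffAt_chartField_T hy).differentiableAt (by simp)
  have hYd : ∀ i, DifferentiableAt ℝ (chartField (Y i) x) y := fun i =>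
    (hY i).differentiableAt_chartField x
  have h := extDeriv_vecCons_eq hA hT hYd (by
    filter_upwards [hn] with z hz v i hv
    rw [chartRep_apply]
    refine hh _ _ i ?_
    rw [hv, dChartSymm_chartField _ hz])
  rw [dirDeriv_eq P.T x (F := fun z => chartRep η x z (fun i => chartField (Y i) x z))
    (hA.continuousAlternatingMap_apply hYd) (fun z hz => chartRep_chartField η hz Y), extD_apply]
  have hcs : ∀ V : VField E M, chartField V x y = dChart x x (V x) := fun V => chartField_self V x
  simp only [hcs] at h
  refine Eq.trans ?_ (h.trans ?_)
  · congr 1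
    ext i
    refine Fin.cases rfl (fun j => rfl) i
  · congr 1
    refine Finset.sum_congr rfl fun l _ => ?_
    rw [← dChart_bracket]
    change _ = η x (fun i => Function.update Y l (bracket P.T (Y l)) i x)
    rw [← chartRep_dChart_self]
    congr 1
    ext i
    by_cases hi : i = l
    · subst hi
      simp
    · simp [hi]

omit [FiniteDimensional ℝ E] [IsManifold 𝓘(ℝ, E) ∞ M] in
theorem dirDeriv_const (V : VField E M) (r : ℝ) (x : M) : dirDeriv V (fun _ => r) x = 0 := by
  have h : mfderiv 𝓘(ℝ, E) 𝓘(ℝ, ℝ) (fun _ : M => r) x = 0 := mfderiv_const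
  exact DFunLike.congr_fun h (V x)

omit [FiniteDimensional ℝ E] [IsManifold 𝓘(ℝ, E) ∞ M] in
theorem dirDeriv_zero_left (f : M → ℝ) (x : M) :
    dirDeriv (fun _ => 0 : VField E M) f x = 0 := by
  unfold dirDeriv
  exact map_zero _

omit [FiniteDimensional ℝ E] in
theorem g_zero_left (x : M) (w : TangentSpace 𝓘(ℝ, E) x) : P.g x 0 w = 0 := by
  unfold g
  rw [(extD P.θ x).map_coord_zero (m := ![0, P.J x w]) 0 rfl, mul_zero]

omit [FiniteDimensional ℝ E] in
theorem g_zero_right (x : M) (w : TangentSpace 𝓘(ℝ, E) x) : P.g x w 0 = 0 := by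
  unfold g
  rw [(extD P.θ x).map_coord_zero (m := ![w, P.J x 0]) 1 (map_zero _), mul_zero]

theorem hor_T : P.hor P.T = fun _ => 0 := by
  ext x
  change P.proj x (P.T x) = 0
  rw [proj_apply, θ_T, one_smul, sub_self]

theorem hor_zero : P.hor (fun _ => 0) = fun _ => 0 := by
  ext x
  exact map_zero _

omit [FiniteDimensional ℝ E] [IsManifold 𝓘(ℝ, E) ∞ M] in
theorem bracket_zero_right (V : VField E M) : bracket V (fun _ => 0) = fun _ => 0 :=
  VectorField.mlieBracket_zero_right

omit [FiniteDimensional ℝ E] [IsManifold 𝓘(ℝ, E) ∞ M] in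
theorem bracket_zero_left (V : VField E M) : bracket (fun _ => 0) V = fun _ => 0 :=
  VectorField.mlieBracket_zero_left

/-- For a zero second field the Koszul right-hand side vanishes, so `0` is a solution and the chosen
vector is a genuine one. A solution is `g`-orthogonal to all of `H`, itself included, hence zero by
positivity. -/
theorem partialNabla_zero_right (V : VField E M) (x : M) :
    P.partialNabla V (fun _ => 0) x = 0 := by
  have hg1 : ∀ Z : VField E M, P.gField (fun _ => 0) Z = fun _ => 0 := fun Z =>
    funext fun y => P.g_zero_left y _
  have hg2 : ∀ Z : VField E M, P.gField Z (fun _ => 0) = fun _ => 0 := fun Z =>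
    funext fun y => P.g_zero_right y _
  have h : ∀ Z : VField E M,
      dirDeriv V (P.gField (fun _ => 0) Z) x + dirDeriv (fun _ => 0 : VField E M) (P.gField V Z) x
          - dirDeriv Z (P.gField V (fun _ => 0)) x
          + P.g x (P.hor (bracket V (fun _ => 0)) x) (Z x)
          - P.g x (P.hor (bracket V Z) x) 0
          - P.g x (P.hor (bracket (fun _ => 0 : VField E M) Z) x) (V x) = 0 := by
    intro Z
    rw [hg1, hg2, dirDeriv_const, dirDeriv_zero_left, dirDeriv_const, bracket_zero_right,
      bracket_zero_left, hor_zero, g_zero_left, g_zero_left, g_zero_right]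
    ring
  have hs := Classical.epsilon_spec (p := fun w : TangentSpace 𝓘(ℝ, E) x => w ∈ P.H x ∧
    ∀ Z : VField E M, SmoothField Z → (∀ y, Z y ∈ P.H y) →
      2 * P.g x w (Z x) =
        dirDeriv V (P.gField (fun _ => 0) Z) x + dirDeriv (fun _ => 0 : VField E M) (P.gField V Z) x
          - dirDeriv Z (P.gField V (fun _ => 0)) x
          + P.g x (P.hor (bracket V (fun _ => 0)) x) (Z x)
          - P.g x (P.hor (bracket V Z) x) 0
          - P.g x (P.hor (bracket (fun _ => 0 : VField E M) Z) x) (V x))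
    ⟨0, (P.H x).zero_mem, fun Z _ _ => by rw [h, g_zero_left, mul_zero]⟩
  change P.partialNabla V (fun _ => 0) x ∈ P.H x ∧ _ at hs
  obtain ⟨hw, hs⟩ := hs
  by_contra hne
  -- The test field is a smooth section of `H` through the chosen vector itself.
  obtain ⟨Z, hZ, hZH, hZx⟩ := P.smooth_H x _ hw
  have h1 := (hs Z hZ hZH).trans (h Z)
  rw [hZx] at h1
  change 2 * P.g x (P.partialNabla V (fun _ => 0) x) (P.partialNabla V (fun _ => 0) x) = 0 at h1
  have h2 : 0 < P.g x (P.partialNabla V (fun _ => 0) x) (P.partialNabla V (fun _ => 0) x) :=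
    P.pos x _ hw hne
  linarith

/-- The characteristic field is parallel. -/
theorem nabla_T (V : VField E M) (x : M) : P.nabla V P.T x = 0 := by
  have h1 : P.thetaOf P.T = fun _ => 1 := funext fun y => P.θ_T y
  have h2 : P.nablaT (fun _ => 0) x = 0 := by
    have h3 : P.JField (fun _ => 0) = fun _ => 0 := funext fun y => map_zero (P.J y)
    unfold nablaT
    rw [h3, bracket_zero_right, map_zero, sub_zero, smul_zero]
  unfold nabla
  rw [hor_T, partialNabla_zero_right, h1, dirDeriv_const, h2, smul_zero, zero_smul, add_zero,
    add_zero]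

/-- On horizontal forms the Lie derivative along `T` is `τ^{[k]} + ∇_T`. -/
theorem tauExt_add_nablaForm {k : ℕ} {η : DiffForm E M k} (hη : SmoothForm η)
    (hh : P.IsHorizontal η) {Y : Fin k → VField E M} (hY : ∀ i, SmoothField (Y i)) (x : M) :
    P.tauExt η Y x + P.nablaForm P.T η Y x =
      extD η x (Matrix.vecCons (P.T x) (fun i => Y i x)) := by
  rw [P.extD_T_apply hη hh hY]
  have hu : ∀ (l : Fin k) (W : VField E M), η.onFields (Function.update Y l W) x =
      η x (Function.update (fun i => Y i x) l (W x)) := by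
    intro l W
    change η x (fun i => Function.update Y l W i x) = _
    congr 1
    ext i
    by_cases hi : i = l
    · subst hi
      simp
    · simp [hi]
  have ht : ∀ l, P.tau (Y l) x = P.nabla P.T (Y l) x - bracket P.T (Y l) x := by
    intro l
    change P.nabla P.T (Y l) x - P.nabla (Y l) P.T x - bracket P.T (Y l) x = _
    rw [nabla_T, sub_zero]
  unfold tauExt nablaForm
  -- The `∇_T Y` terms now occur with opposite signs and cancel, whatever vectors they are.
  simp only [hu, ht, (η x).map_update_sub, Finset.sum_sub_distrib]
  ring

end PseudoHermitian

/-! ### Smooth functions as `0`-forms, and a function with nonzero derivative. -/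

section Functions

variable {E : Type*} [NormedAddCommGroup E] [NormedSpace ℝ E]
  {M : Type*} [TopologicalSpace M] [ChartedSpace E M] [IsManifold 𝓘(ℝ, E) ∞ M]

theorem smoothForm_zeroForm {f : M → ℝ} (hf : ContMDiff 𝓘(ℝ, E) 𝓘(ℝ, ℝ) ∞ f) :
    SmoothForm (zeroForm f : DiffForm E M 0) := by
  intro c
  have h1 : ContDiffOn ℝ ∞ (f ∘ (extChartAt 𝓘(ℝ, E) c).symm) (extChartAt 𝓘(ℝ, E) c).target :=
    contMDiffOn_iff_contDiffOn.1 (hf.comp_contMDiffOn (contMDiffOn_extChartAt_symm c))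
  let L : ℝ →L[ℝ] (E [⋀^Fin 0]→L[ℝ] ℝ) :=
    (ContinuousAlternatingMap.constOfIsEmptyLIE ℝ E ℝ
      (Fin 0)).toContinuousLinearEquiv.toContinuousLinearMap
  exact L.contDiff.comp_contDiffOn h1

end Functions

section Bump

variable {E : Type*} [NormedAddCommGroup E] [NormedSpace ℝ E] [FiniteDimensional ℝ E]
  {M : Type*} [TopologicalSpace M] [T2Space M] [ChartedSpace E M] [IsManifold 𝓘(ℝ, E) ∞ M]

/-- Take a functional nonzero on the chart image of `V x`, compose it with the chart and cut off by
a bump function equal to `1` near `x`. -/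
theorem exists_contMDiff_dirDeriv_ne_zero (V : VField E M) (x : M) (hV : V x ≠ 0) :
    ∃ f : M → ℝ, ContMDiff 𝓘(ℝ, E) 𝓘(ℝ, ℝ) ∞ f ∧ dirDeriv V f x ≠ 0 := by
  have hw : dChart x x (V x) ≠ 0 := by
    intro h0
    have h := dChartSymm_comp_dChart (mem_extChartAt_target (I := 𝓘(ℝ, E)) x)
    rw [extChartAt_to_inv] at h
    have h1 := DFunLike.congr_fun h (V x)
    exact hV (h1.symm.trans ((congrArg (dChartSymm x _) h0).trans (map_zero _)))
  obtain ⟨ℓ, -, hℓ⟩ := exists_dual_vector ℝ (dChart x x (V x)) (norm_ne_zero_iff.2 hw)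
  obtain ⟨b⟩ : Nonempty (SmoothBumpFunction 𝓘(ℝ, E) x) := inferInstance
  refine ⟨fun z => b z • ℓ (extChartAt 𝓘(ℝ, E) x z), ?_, ?_⟩
  · refine b.contMDiff_smul ?_
    exact ℓ.contDiff.contMDiff.comp_contMDiffOn contMDiffOn_extChartAt
  · have h1 : (fun z => b z • ℓ (extChartAt 𝓘(ℝ, E) x z)) =ᶠ[𝓝 x]
        ℓ ∘ extChartAt 𝓘(ℝ, E) x := by
      filter_upwards [b.eventuallyEq_one] with z hz
      simp [hz]
    have h2 := mfderiv_comp x ℓ.differentiableAt.mdifferentiableAt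
      ((contMDiffAt_extChartAt_of_mem (E := E)
        (mem_extChartAt_source (I := 𝓘(ℝ, E)) x)).mdifferentiableAt (by simp))
    rw [mfderiv_eq_fderiv, ℓ.fderiv] at h2
    have h3 := h1.mfderiv_eq (I := 𝓘(ℝ, E)) (I' := 𝓘(ℝ, ℝ))
    have h4 : dirDeriv V (fun z => b z • ℓ (extChartAt 𝓘(ℝ, E) x z)) x =
        ℓ (dChart x x (V x)) :=
      (DFunLike.congr_fun h3 (V x)).trans (DFunLike.congr_fun h2 (V x))
    rw [h4, hℓ]
    simpa using hw

end Bump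

/-! ### The formula on forms and functions, and nonvanishing. -/

namespace PseudoHermitian

variable {E : Type*} [NormedAddCommGroup E] [NormedSpace ℝ E] [FiniteDimensional ℝ E]
  {M : Type*} [TopologicalSpace M] [ChartedSpace E M] [IsManifold 𝓘(ℝ, E) ∞ M]
  (P : PseudoHermitian E M)

theorem dW_dW_onFields {k : ℕ} {η : DiffForm E M k} (hη : SmoothForm η) (hh : P.IsHorizontal η)
    {Y : Fin (k + 2) → VField E M} (hY : ∀ i, SmoothField (Y i)) (x : M) :
    (P.dW (P.dW η)).onFields Y x =
      - wedge (Nat.add_comm 2 k) (extD P.θ).onFields (P.tauExt η) Y x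
        - wedge (Nat.add_comm 2 k) (extD P.θ).onFields (P.nablaForm P.T η) Y x := by
  refine (P.dW_dW_apply hη x _).trans ?_
  unfold wedge
  rw [← neg_add', ← mul_add, ← Finset.sum_add_distrib, neg_mul]
  congr 2
  refine Finset.sum_congr rfl fun σ _ => ?_
  rw [← mul_add, ← mul_add, P.tauExt_add_nablaForm hη hh fun j => hY _]
  congr 2
  · change extD P.θ x _ = extD P.θ x _
    congr 1
    ext i
    fin_cases i <;> rfl
  · congr 2
    ext j
    have : Fin.cast (Nat.add_comm 2 k) (Fin.natAdd 2 j) = j.succ.succ := by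
      ext
      simp
    rw [this]

theorem dW_dW_zeroForm {f : M → ℝ} (hf : ContMDiff 𝓘(ℝ, E) 𝓘(ℝ, ℝ) ∞ f) (x : M) :
    P.dW (P.dW (zeroForm f)) x = -(dirDeriv P.T f x • extD P.θ x) := by
  have hs := smoothForm_zeroForm (E := E) hf
  have hT : ∀ v : Fin 0 → TangentSpace 𝓘(ℝ, E) x,
      extD (zeroForm f) x (Matrix.vecCons (P.T x) v) = dirDeriv P.T f x := by
    intro v
    have h := P.extD_T_apply hs (fun _ _ i => i.elim0) (Y := fun i => i.elim0)
      (fun i => i.elim0) x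
    rw [Finset.univ_eq_empty, Finset.sum_empty, sub_zero] at h
    rw [Subsingleton.elim v]
    exact h
  ext v
  rw [P.dW_dW_apply hs]
  simp only [hT]
  have h2 : ∀ a b : TangentSpace 𝓘(ℝ, E) x, extD P.θ x ![b, a] = -extD P.θ x ![a, b] := by
    intro a b
    have h3 := (extD P.θ x).toAlternatingMap.map_swap ![a, b] (i := 0) (j := 1) (by decide)
    refine Eq.trans ?_ h3
    change _ = extD P.θ x _
    congr 1
    ext i
    fin_cases i <;> rfl
  have h4 : ![v 0, v 1] = v := by
    ext i
    fin_cases i <;> rfl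
  -- The two permutations contribute equally, cancelling the factor `1 / (2! 0!)`.
  have h5 : (Finset.univ : Finset (Equiv.Perm (Fin 2))) = {1, Equiv.swap 0 1} := by decide
  rw [h5, Finset.sum_pair (by decide)]
  have h6 : Equiv.Perm.sign (Equiv.swap (0 : Fin 2) 1) = -1 := Equiv.Perm.sign_swap (by decide)
  rw [h6]
  simp only [Equiv.swap_apply_left, Equiv.swap_apply_right, Equiv.Perm.one_apply, h2 (v 0) (v 1), h4]
  change _ = -(dirDeriv P.T f x * extD P.θ x v)
  simp
  ring

/-- Corank one leaves `H` of positive dimension, and `dθ(v, Jv) > 0` for a nonzero `v` in it. -/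
theorem extD_θ_ne_zero (hE : 2 ≤ Module.finrank ℝ E) (x : M) : extD P.θ x ≠ 0 := by
  have : FiniteDimensional ℝ (TangentSpace 𝓘(ℝ, E) x) := inferInstanceAs (FiniteDimensional ℝ E)
  have h1 := Submodule.finrank_quotient_add_finrank (P.H x)
  rw [P.corank_one] at h1
  have h2 : Module.finrank ℝ (TangentSpace 𝓘(ℝ, E) x) = Module.finrank ℝ E := rfl
  have h3 : P.H x ≠ ⊥ := by
    intro h
    rw [h, finrank_bot, h2] at h1
    omega
  obtain ⟨v, hv, hv0⟩ := Submodule.exists_mem_ne_zero_of_ne_bot h3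
  intro h
  have := P.pos x v hv hv0
  rw [h] at this
  simp at this

theorem exists_dW_dW_ne_zero [T2Space M] [Nonempty M] (hE : 2 ≤ Module.finrank ℝ E) :
    ∃ f : M → ℝ, ContMDiff 𝓘(ℝ, E) 𝓘(ℝ, ℝ) ∞ f ∧ P.dW (P.dW (zeroForm f)) ≠ 0 := by
  obtain ⟨x⟩ := ‹Nonempty M›
  have hT : P.T x ≠ 0 := by
    intro h
    have h1 := P.θ_T x
    rw [h, (P.θ x).map_coord_zero (m := ![0]) 0 rfl] at h1
    exact zero_ne_one h1
  obtain ⟨f, hf, hfT⟩ := exists_contMDiff_dirDeriv_ne_zero P.T x hT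
  refine ⟨f, hf, fun h => ?_⟩
  have h1 := (P.dW_dW_zeroForm hf x).symm.trans (congrFun h x)
  exact (smul_ne_zero hfT (P.extD_θ_ne_zero hE x)) (neg_eq_zero.1 h1)

end PseudoHermitian

end CRGeometry

end

theorem mainTheorem9 (m : ℕ) (hm : 1 ≤ m)
    {M : Type*} [TopologicalSpace M] [T2Space M] [SecondCountableTopology M] [ConnectedSpace M]
    [ChartedSpace (EuclideanSpace ℝ (Fin (2 * m + 1))) M]
    [IsManifold 𝓘(ℝ, EuclideanSpace ℝ (Fin (2 * m + 1))) ∞ M]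
    (P : CRGeometry.PseudoHermitian (EuclideanSpace ℝ (Fin (2 * m + 1))) M) :
    -- the formula for the square of the horizontal differential on horizontal `k`-forms
    (∀ (k : ℕ) (η : CRGeometry.DiffForm (EuclideanSpace ℝ (Fin (2 * m + 1))) M k),
      CRGeometry.SmoothForm η → P.IsHorizontal η →
      ∀ Y : Fin (k + 2) → CRGeometry.VField (EuclideanSpace ℝ (Fin (2 * m + 1))) M,
        (∀ i, CRGeometry.SmoothField (Y i)) → ∀ x : M,
          (P.dW (P.dW η)).onFields Y x =
            - CRGeometry.wedge (Nat.add_comm 2 k)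
                (CRGeometry.extD P.θ).onFields (P.tauExt η) Y x
            - CRGeometry.wedge (Nat.add_comm 2 k)
                (CRGeometry.extD P.θ).onFields (P.nablaForm P.T η) Y x) ∧
    -- the case of functions
    (∀ f : M → ℝ, ContMDiff 𝓘(ℝ, EuclideanSpace ℝ (Fin (2 * m + 1))) 𝓘(ℝ, ℝ) ∞ f → ∀ x : M,
      P.dW (P.dW (CRGeometry.zeroForm f)) x =
        -(CRGeometry.dirDeriv P.T f x • CRGeometry.extD P.θ x)) ∧
    -- the square does not vanish
    (∃ f : M → ℝ, ContMDiff 𝓘(ℝ, EuclideanSpace ℝ (Fin (2 * m + 1))) 𝓘(ℝ, ℝ) ∞ f ∧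
      P.dW (P.dW (CRGeometry.zeroForm f)) ≠ 0) := by
  have : Nonempty M := ConnectedSpace.toNonempty
  refine ⟨fun k η hη hh Y hY x => P.dW_dW_onFields hη hh hY x,
    fun f hf x => P.dW_dW_zeroForm hf x, P.exists_dW_dW_ne_zero ?_⟩
  rw [finrank_euclideanSpace_fin]
  omega
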